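/- **Setting.** Consider the multi-sender unicast index-coding problem with messages $M_1,\dots,M_4$, fifteen senders, one for each nonempty set $\mathcal S_k\subseteq\{1,2,3,4\}$ of messages ($k=1,\dots,15$), each connected to all receivers by a noiseless broadcast link of capacity $C_k=1$ bit per channel use, and four receivers, where receiver $j$ requests $M_j$ and knows the messages indexed by $\mathcal A_j$, with $\mathcal A_1=\{4\}$, $\mathcal A_2=\{3,4\}$, $\mathcal A_3=\{1,2\}$, $\mathcal A_4=\{2,3\}$. **Capacity region.** For rates $R=(R_1,\dots,R_4)\in\mathbb R_+^4$ and block length $n$, the messages are independent and $M_j$ is uniform on $\{1,\dots,2^{\lceil nR_j\rceil}\}$. A code consists of encoders, where sender $k$ maps $(M_i)_{i\in\mathcal S_k}$ to an index $L_k\in\{1,\dots,2^{\lfloor nC_k\rfloor}\}$, and decoders, where receiver $j$ maps $(L_1,\dots,L_{15})$ and $(M_i)_{i\in\mathcal A_j}$ to an estimate $\hat M_j$. A rate tuple is achievable if there are codes of all block lengths $n$ with $\Pr[(\hat M_1,\dots,\hat M_4)\ne(M_1,\dots,M_4)]\to0$ as $n\to\infty$. The capacity region $\mathcal C$ is the closure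 of the set of achievable rate tuples. **Cooperative composite coding (CCC), all senders in one group.** A decoding choice is a family $D=(\mathcal D_j)_{j}$ with $j\in\mathcal D_j\subseteq\{1,2,3,4\}\setminus\mathcal A_j$. Let $\mathcal R_{\mathrm C}(D)$ be the set of all $R\in\mathbb R_+^4$ for which there are composite rates $\gamma_{\mathcal J}\ge0$, for the sets $\mathcal J$ contained in some $\mathcal S_k$, with $$\sum_{i\in\mathcal T}R_i<\sum_{\mathcal J\subseteq\mathcal D_j\cup\mathcal A_j,\ \mathcal J\cap\mathcal T\ne\emptyset}\gamma_{\mathcal J}\quad\text{for all } j \text{ and all } \emptyset\ne\mathcal T\subseteq\mathcal D_j,$$ $$\sum_{\mathcal J}\gamma_{\mathcal J}<\sum_{k\in\mathcal K}C_k\quad\text{for all } j \text{ and all } \emptyset\ne\mathcal K\subseteq\{1,\dots,15\},$$ where the last sum on the left is over the sets $\mathcal J\not\subseteq\mathcal A_j$ that are contained in some $\mathcal S_k$ with $k\in\mathcal K$ and in no $\mathcal S_k$ with $k\notin\mathcal K$. Let $\mathcal R_{\mathrm C}$ be the convex hull of the union of $\mathcal R_{\mathrm C}(D)$ over all decoding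 choices $D$. **MAIS bound.** Let $G$ be the digraph on $\{1,2,3,4\}$ with an arc from $i$ to $j$ if $j\in\mathcal A_i$, and let $\mathcal R_{\mathrm{MAIS}}$ be the set of all $R\in\mathbb R_+^4$ with $\sum_{j\in V}R_j\le\sum_{k:\,\mathcal S_k\cap V\ne\emptyset}C_k$ for every $V$ for which the subgraph of $G$ induced by $V$ is acyclic. **Theorem.** 1. For the decoding choice $D^*$ with $\mathcal D_1=\{1\}$ and $\mathcal D_j=\{1,2,3,4\}\setminus\mathcal A_j$ for $j=2,3,4$, $$\mathcal R_{\mathrm C}=\mathcal R_{\mathrm C}(D^*)=\left\{R\in\mathbb R_+^4:\ \begin{array}{l}R_1,R_2,R_3,R_4<8,\\ R_1+R_2<12,\ R_1+R_3<12,\\ R_1+R_4<12,\ R_3+R_4<12,\\ R_1+R_2+R_3<18\end{array}\right\}.$$ 2. The closure of $\mathcal R_{\mathrm C}$ is the capacity region: $\overline{\mathcal R_{\mathrm C}}=\mathcal C$. Explicitly, $\mathcal C$ is the set of all $R\in\mathbb R_+^4$ that satisfy the inequalities of part 1 with $\le$ in place of $<$; in particular every achievable rate tuple satisfies $R_1+R_2+R_3\le18$.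 3. The MAIS outer bound is not tight: $\mathcal C\subsetneq\mathcal R_{\mathrm{MAIS}}$. -/

import Mathlib

open Filter Topology

namespace IndexCoding

/-- A multi-sender unicast index-coding problem with `N` messages (and `N` receivers, receiver `j`
requesting message `j`) and `K` senders. -/
structure Problem (N K : ℕ) where
  /-- `S k` is the set of indices of the messages available at sender `k`. -/
  S : Fin K → Finset (Fin N)
  /-- `A j` is the set of indices of the messages known a priori at receiver `j`. -/
  A : Fin N → Finset (Fin N)
  /-- `C k` is the capacity of the broadcast link of sender `k`, in bits per channel use. -/
  C : Fin K → ℝ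
  S_nonempty : ∀ k, (S k).Nonempty
  S_injective : Function.Injective S
  S_cover : ∀ i, ∃ k, i ∈ S k
  not_mem_A : ∀ j, j ∉ A j
  C_pos : ∀ k, 0 < C k

/-- The number of values of a message of rate `r` at block length `n`. -/
noncomputable def msgSize (n : ℕ) (r : ℝ) : ℕ := 2 ^ ⌈(n : ℝ) * r⌉₊

/-- The number of values of a link index of a link of capacity `c` at block length `n`. -/
noncomputable def linkSize (n : ℕ) (c : ℝ) : ℕ := 2 ^ ⌊(n : ℝ) * c⌋₊

/-- The tuples of all messages, at rates `R` and block length `n`. -/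
abbrev Messages {N : ℕ} (R : Fin N → ℝ) (n : ℕ) : Type :=
  ∀ i : Fin N, Fin (msgSize n (R i))

/-- A multi-sender index code for message rates `R` and block length `n`. -/
structure Code {N K : ℕ} (P : Problem N K) (R : Fin N → ℝ) (n : ℕ) where
  /-- The encoder of sender `k` sees the messages indexed by `S k` only. -/
  enc : ∀ k : Fin K,
    (∀ i : {i : Fin N // i ∈ P.S k}, Fin (msgSize n (R i.1))) → Fin (linkSize n (P.C k))
  /-- The decoder of receiver `j` sees all link indices and the messages indexed by `A j`. -/
  dec : ∀ j : Fin N,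
    (∀ k : Fin K, Fin (linkSize n (P.C k))) →
    (∀ i : {i : Fin N // i ∈ P.A j}, Fin (msgSize n (R i.1))) → Fin (msgSize n (R j))

/-- The indices sent by all senders when the messages are `m`. -/
def Code.links {N K : ℕ} {P : Problem N K} {R : Fin N → ℝ} {n : ℕ} (c : Code P R n)
    (m : Messages R n) : ∀ k : Fin K, Fin (linkSize n (P.C k)) :=
  fun k => c.enc k (fun i => m i.1)

/-- The message estimates of all receivers when the messages are `m`. -/
def Code.estimate {N K : ℕ} {P : Problem N K} {R : Fin N → ℝ} {n : ℕ} (c : Code P R n)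
    (m : Messages R n) : Messages R n :=
  fun j => c.dec j (c.links m) (fun i => m i.1)

/-- The average probability of error, for messages that are independent and uniformly
distributed, i.e. for a message tuple that is uniformly distributed over the product set. -/
noncomputable def Code.errorProb {N K : ℕ} {P : Problem N K} {R : Fin N → ℝ} {n : ℕ}
    (c : Code P R n) : ℝ :=
  (Nat.card {m : Messages R n // c.estimate m ≠ m} : ℝ) / (Nat.card (Messages R n) : ℝ)

/-- A rate tuple is achievable if it admits a sequence of codes, one for each block length, with
vanishing probability of error. -/
def Achievable {N K : ℕ} (P : Problem N K) (R : Fin N → ℝ) : Prop :=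
  (∀ j, 0 ≤ R j) ∧
    ∃ c : ∀ n : ℕ, Code P R n, Tendsto (fun n => (c n).errorProb) atTop (𝓝 0)

/-- The capacity region. -/
def capacityRegion {N K : ℕ} (P : Problem N K) : Set (Fin N → ℝ) :=
  closure {R | Achievable P R}

/-- `D` is a decoding choice: receiver `j` decodes the messages indexed by `D j`, which contains
`j` and none of the side information of receiver `j`. -/
def IsDecodingChoice {N K : ℕ} (P : Problem N K) (D : Fin N → Finset (Fin N)) : Prop :=
  ∀ j, j ∈ D j ∧ Disjoint (D j) (P.A j)

/-- The polymatroidal rate region of Cooperative Composite Coding with all senders in one group,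
for the decoding choice `D`. The composite rate `γ J` is used for those sets `J` of messages only
that are available at some sender. -/
def cccRegionOf {N K : ℕ} (P : Problem N K) (D : Fin N → Finset (Fin N)) : Set (Fin N → ℝ) :=
  {R | (∀ j, 0 ≤ R j) ∧ ∃ γ : Finset (Fin N) → ℝ,
    (∀ k, ∀ J ⊆ P.S k, 0 ≤ γ J) ∧
    (∀ j, ∀ T ⊆ D j, T.Nonempty →
      ∑ i ∈ T, R i <
        ∑ J : Finset (Fin N) with
          (∃ k, J ⊆ P.S k) ∧ J ⊆ D j ∪ P.A j ∧ (J ∩ T).Nonempty, γ J) ∧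
    (∀ j, ∀ Q : Finset (Fin K), Q.Nonempty →
      ∑ J : Finset (Fin N) with
          (∃ k ∈ Q, J ⊆ P.S k) ∧ ¬ (∃ k ∈ Qᶜ, J ⊆ P.S k) ∧ ¬ J ⊆ P.A j, γ J <
        ∑ k ∈ Q, P.C k)}

/-- The rate region of Cooperative Composite Coding with all senders in one group: the convex hull
of the union of the rate regions over all decoding choices. -/
def cccRegion {N K : ℕ} (P : Problem N K) : Set (Fin N → ℝ) :=
  convexHull ℝ (⋃ D ∈ {D | IsDecodingChoice P D}, cccRegionOf P D)

/-- The subgraph induced by `V` of the side-information digraph, with an arc from `i` to `j` if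
receiver `i` knows message `j`, has no directed cycle. -/
def InducedAcyclic {N K : ℕ} (P : Problem N K) (V : Finset (Fin N)) : Prop :=
  ∀ v, ¬ Relation.TransGen (fun i j => i ∈ V ∧ j ∈ V ∧ j ∈ P.A i) v v

/-- The region of the (generalized) maximal-acyclic-induced-subgraph outer bound. -/
def maisRegion {N K : ℕ} (P : Problem N K) : Set (Fin N → ℝ) :=
  {R | (∀ j, 0 ≤ R j) ∧ ∀ V : Finset (Fin N), InducedAcyclic P V →
    ∑ j ∈ V, R j ≤ ∑ k with (P.S k ∩ V).Nonempty, P.C k}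

/-- The instance with four messages and fifteen senders, one for each nonempty set of messages, all
with unit link capacity, and with side information `{4}`, `{3,4}`, `{1,2}`, `{2,3}` at the
receivers `1`, `2`, `3`, `4`. Messages and receivers are numbered from `0` here. -/
def fifteenSenders : Problem 4 15 where
  S := ![{0}, {1}, {2}, {3}, {0, 1}, {0, 2}, {2, 3}, {1, 2}, {1, 3}, {0, 3},
    {0, 1, 2}, {0, 1, 3}, {0, 2, 3}, {1, 2, 3}, {0, 1, 2, 3}]
  A := ![{3}, {2, 3}, {0, 1}, {1, 2}]
  C := fun _ => 1
  S_nonempty := by decide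
  S_injective := by decide
  S_cover := by decide
  not_mem_A := by decide
  C_pos := fun _ => one_pos

/-- The decoding choice with `D 1 = {1}` and `D j` the complement of the side information of
receiver `j` for `j = 2, 3, 4` (in the numbering from `1`). -/
def fifteenSendersChoice : Fin 4 → Finset (Fin 4) :=
  fun j => if j = 0 then {0} else (fifteenSenders.A j)ᶜ

end IndexCoding

namespace IndexCoding

/-! Both regions are squeezed onto one polytope. For composite coding,
`cccRegionOf_subset_openPolytope` and `openPolytope_subset_cccRegionOf` place the region of every
decoding choice inside the region of the distinguished one. For the capacity, the achievable tuples
lie between the open polytope (`openPolytope_subset_achievable`) and its closure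
(`achievable_subset_closedPolytope`).

Both inner bounds rest on six integer vertices whose convex combinations dominate the polytope. At
each vertex there are integer composite rates, and independently a scalar binary linear code with
zero error; finite checks verify both, and mixing or time sharing does the rest.

The new converse is `R 0 + R 1 + R 2 ≤ 18`. In entropy terms: given messages 0, 3 and the eleven
links that do not see 1 and 2 together, messages 1 and 2 are independent. Receiver 2 finds message 2
from 0, 1 and all links, so under this conditioning messages 1 and 2 jointly have at most the
entropy of 1 plus that of the four remaining links; by independence, 2 has entropy at most `4 * n`.
Now let message 3 be known. The other fourteen links cost `14 * n` and reveal message 0, message 2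
then costs at most `4 * n`, and message 1 follows from 2, 3 and the links. `prod_msgSize_triple_le`
carries this out by counting. Since messages 1 and 2 form a 2-cycle, the MAIS bound does not see
this triple. -/

/-- The open polytope of rates. -/
def openPolytope : Set (Fin 4 → ℝ) :=
  {R | (∀ j, 0 ≤ R j) ∧ (∀ j, R j < 8) ∧
    R 0 + R 1 < 12 ∧ R 0 + R 2 < 12 ∧ R 0 + R 3 < 12 ∧ R 2 + R 3 < 12 ∧
    R 0 + R 1 + R 2 < 18}

/-- The closed polytope of rates. -/
def closedPolytope : Set (Fin 4 → ℝ) :=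
  {R | (∀ j, 0 ≤ R j) ∧ (∀ j, R j ≤ 8) ∧
    R 0 + R 1 ≤ 12 ∧ R 0 + R 2 ≤ 12 ∧ R 0 + R 3 ≤ 12 ∧ R 2 + R 3 ≤ 12 ∧
    R 0 + R 1 + R 2 ≤ 18}

/-! ### Composite coding: outer bound for every decoding choice -/

lemma subset_sender (J : Finset (Fin 4)) : J ⊆ fifteenSenders.S 14 := by
  revert J; decide

lemma mem_of_inter_singleton_nonempty {α : Type*} [DecidableEq α] {J : Finset α} {i : α}
    (h : (J ∩ {i}).Nonempty) : i ∈ J := by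
  obtain ⟨x, hx⟩ := h
  obtain ⟨hx, hxi⟩ := Finset.mem_inter.1 hx
  exact Finset.mem_singleton.1 hxi ▸ hx

/-- A linear inequality between sums of nonnegative weights follows from the inequality between
the multiplicities. -/
lemma sum_filter_add_le {ι : Type*} [Fintype ι] {w : ι → ℝ} (hw : ∀ i, 0 ≤ w i)
    (p₁ p₂ p₃ q₁ q₂ : ι → Prop) [DecidablePred p₁] [DecidablePred p₂] [DecidablePred p₃]
    [DecidablePred q₁] [DecidablePred q₂]
    (h : ∀ i, (if p₁ i then 1 else 0) + (if p₂ i then 1 else 0) + (if p₃ i then 1 else 0) ≤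
      (if q₁ i then 1 else 0) + (if q₂ i then 1 else 0 : ℕ)) :
    ∑ i with p₁ i, w i + ∑ i with p₂ i, w i + ∑ i with p₃ i, w i ≤
      ∑ i with q₁ i, w i + ∑ i with q₂ i, w i := by
  simp only [Finset.sum_filter, ← Finset.sum_add_distrib]
  refine Finset.sum_le_sum fun i _ => ?_
  have h1 := mul_le_mul_of_nonneg_right (Nat.cast_le (α := ℝ).2 (h i)) (hw i)
  push_cast at h1
  simpa [add_mul, ite_mul] using h1

/-- The open polytope contains the CCC region of every decoding choice. -/
lemma cccRegionOf_subset_openPolytope {D : Fin 4 → Finset (Fin 4)}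
    (hD : IsDecodingChoice fifteenSenders D) :
    cccRegionOf fifteenSenders D ⊆ openPolytope := by
  rintro R ⟨hR, γ, hγ, hdec, hlink⟩
  have hγ0 : ∀ J, 0 ≤ γ J := fun J => hγ 14 J (subset_sender J)
  have dec_le : ∀ (j : Fin 4) (T : Finset (Fin 4)) (p : Finset (Fin 4) → Prop) [DecidablePred p],
      T ⊆ D j → T.Nonempty →
      (∀ J, J ⊆ D j ∪ fifteenSenders.A j → (J ∩ T).Nonempty → p J) →
      ∑ i ∈ T, R i < ∑ J with p J, γ J := by
    intro j T p _ hT hne hp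
    refine (hdec j T hT hne).trans_le
      (Finset.sum_le_sum_of_subset_of_nonneg ?_ fun J _ _ => hγ0 J)
    intro J
    simp only [Finset.mem_filter, Finset.mem_univ, true_and]
    exact fun h => hp J h.2.1 h.2.2
  have mem_le : ∀ i : Fin 4, R i < ∑ J with i ∈ J, γ J := by
    intro i
    have := dec_le i {i} (fun J => i ∈ J) (by simpa using (hD i).1) (by simp)
      (fun J _ h => mem_of_inter_singleton_nonempty h)
    simpa using this
  -- Link constraint for the senders that see `U`: a composite meeting `U` fits into no other
  -- sender, and every composite fits into sender 14, which has all messages.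
  have hit_lt : ∀ (j : Fin 4) (U : Finset (Fin 4)) (c : ℕ), U.Nonempty →
      (Finset.univ.filter fun k => (fifteenSenders.S k ∩ U).Nonempty).card = c →
      ∑ J with (J ∩ U).Nonempty ∧ ¬ J ⊆ fifteenSenders.A j, γ J < c := by
    intro j U c hU hc
    have h14 : (14 : Fin 15) ∈
        Finset.univ.filter fun k => (fifteenSenders.S k ∩ U).Nonempty := by
      simpa [Finset.inter_eq_right.2 (subset_sender U)] using hU
    refine (Finset.sum_le_sum_of_subset_of_nonneg ?_ fun J _ _ => hγ0 J).trans_lt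
      ((hlink j _ ⟨14, h14⟩).trans_eq ?_)
    · intro J
      simp only [Finset.mem_filter, Finset.mem_univ, true_and]
      rintro ⟨h1, h2⟩
      refine ⟨⟨14, by simpa using h14, subset_sender J⟩, ?_, h2⟩
      rintro ⟨k, hk, hJ⟩
      simp only [Finset.mem_compl, Finset.mem_filter, Finset.mem_univ, true_and] at hk
      exact hk (h1.mono (Finset.inter_subset_inter_right hJ))
    · simp [fifteenSenders, ← hc]
  have single : ∀ i, R i < 8 := by
    intro i
    have h1 := mem_le i
    have h2 := hit_lt i {i} 8 (by simp) (by clear * -; revert i; decide)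
    have h3 := sum_filter_add_le hγ0 (fun J => i ∈ J) (fun _ => False) (fun _ => False)
      (fun J => (J ∩ {i}).Nonempty ∧ ¬ J ⊆ fifteenSenders.A i) (fun _ => False)
      (by clear * -; revert i; decide)
    simp only [Finset.filter_false, Finset.sum_empty, add_zero] at h3
    push_cast at h2
    linarith
  have pair : ∀ u v : Fin 4, u ≠ v → v ∉ fifteenSenders.A u → R u + R v < 12 := by
    intro u v huv hv
    have h2 := hit_lt u {u, v} 12 (by simp) (by clear hv; revert u v; decide)
    push_cast at h2
    have hu := (hD u).1
    -- If receiver `u` does not decode `v`, it uses only composites avoiding `v`, which are disjoint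
    -- from those that can serve receiver `v`. Either way `R u + R v` is paid for by composites
    -- meeting `{u, v}`, none of them known to `u`.
    by_cases hvD : v ∈ D u
    · have h1 := dec_le u {u, v}
        (fun J => (J ∩ {u, v}).Nonempty)
        (by intro x; simp only [Finset.mem_insert, Finset.mem_singleton]; rintro (rfl | rfl) <;>
            assumption) (by simp) (fun J _ h => h)
      rw [Finset.sum_pair huv] at h1
      have h3 := sum_filter_add_le hγ0 (fun J => (J ∩ {u, v}).Nonempty) (fun _ => False)
        (fun _ => False)
        (fun J => (J ∩ {u, v}).Nonempty ∧ ¬ J ⊆ fifteenSenders.A u) (fun _ => False)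
        (by clear * - huv hv; revert u v; decide)
      simp only [Finset.filter_false, Finset.sum_empty, add_zero] at h3
      linarith
    · have h1 := dec_le u {u} (fun J => u ∈ J ∧ v ∉ J) (by simpa using hu) (by simp) (by
        intro J hJ h
        refine ⟨mem_of_inter_singleton_nonempty h, fun hvJ => ?_⟩
        have := hJ hvJ
        simp [hvD, hv] at this)
      have h4 := mem_le v
      have h3 := sum_filter_add_le hγ0 (fun J => u ∈ J ∧ v ∉ J) (fun J => v ∈ J)
        (fun _ => False)
        (fun J => (J ∩ {u, v}).Nonempty ∧ ¬ J ⊆ fifteenSenders.A u) (fun _ => False)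
        (by clear * - huv hv; revert u v; decide)
      simp only [Finset.filter_false, Finset.sum_empty, add_zero, Finset.sum_singleton] at h3 h1
      linarith
  refine ⟨hR, single, pair 0 1 (by decide) (by decide), pair 0 2 (by decide) (by decide), ?_,
    ?_, ?_⟩
  · have := pair 3 0 (by decide) (by decide)
    linarith
  · have := pair 2 3 (by decide) (by decide)
    linarith
  · have h14 := hit_lt 0 {0, 1, 2} 14 (by decide) (by decide)
    -- These four are the senders that have both 1 and 2. Composites containing both can be counted
    -- once for each of receivers 1 and 2, which is the excess of 18 over 14.
    have h4 : ∑ J with 1 ∈ J ∧ 2 ∈ J, γ J < 4 := by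
      refine (Finset.sum_le_sum_of_subset_of_nonneg ?_ fun J _ _ => hγ0 J).trans_lt
        ((hlink 0 {7, 10, 13, 14} (by simp)).trans_eq ?_)
      · decide
      · simp [fifteenSenders]
    have hA : fifteenSenders.A 0 = {3} := rfl
    have h0 := (hD 0).1
    push_cast at h14
    have m1 := mem_le 1
    have m2 := mem_le 2
    by_cases h1D : 1 ∈ D 0
    · by_cases h2D : 2 ∈ D 0
      · have h := dec_le 0 {0, 1, 2} (fun J => (J ∩ {0, 1, 2}).Nonempty)
          (by simp [Finset.insert_subset_iff, h0, h1D, h2D]) (by simp) (fun J _ h => h)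
        have h3 := sum_filter_add_le hγ0 (fun J => (J ∩ {0, 1, 2}).Nonempty) (fun _ => False)
          (fun _ => False) (fun J => (J ∩ {0, 1, 2}).Nonempty ∧ ¬ J ⊆ fifteenSenders.A 0)
          (fun _ => False) (by decide)
        simp only [Finset.filter_false, Finset.sum_empty, add_zero] at h3
        have e : ∑ i ∈ ({0, 1, 2} : Finset (Fin 4)), R i = R 0 + R 1 + R 2 := by
          simp [Finset.sum_insert, add_assoc]
        linarith
      · have h := dec_le 0 {0, 1} (fun J => (J ∩ {0, 1}).Nonempty ∧ 2 ∉ J)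
          (by simp [Finset.insert_subset_iff, h0, h1D]) (by simp)
          (fun J hJ h => ⟨h, fun hm => by simpa [h2D, hA] using hJ hm⟩)
        have h3 := sum_filter_add_le hγ0 (fun J => (J ∩ {0, 1}).Nonempty ∧ 2 ∉ J) (fun J => 2 ∈ J)
          (fun _ => False) (fun J => (J ∩ {0, 1, 2}).Nonempty ∧ ¬ J ⊆ fifteenSenders.A 0)
          (fun _ => False) (by decide)
        simp only [Finset.filter_false, Finset.sum_empty, add_zero] at h3
        rw [Finset.sum_pair (by decide)] at h
        linarith
    · by_cases h2D : 2 ∈ D 0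
      · have h := dec_le 0 {0, 2} (fun J => (J ∩ {0, 2}).Nonempty ∧ 1 ∉ J)
          (by simp [Finset.insert_subset_iff, h0, h2D]) (by simp)
          (fun J hJ h => ⟨h, fun hm => by simpa [h1D, hA] using hJ hm⟩)
        have h3 := sum_filter_add_le hγ0 (fun J => (J ∩ {0, 2}).Nonempty ∧ 1 ∉ J) (fun J => 1 ∈ J)
          (fun _ => False) (fun J => (J ∩ {0, 1, 2}).Nonempty ∧ ¬ J ⊆ fifteenSenders.A 0)
          (fun _ => False) (by decide)
        simp only [Finset.filter_false, Finset.sum_empty, add_zero] at h3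
        rw [Finset.sum_pair (by decide)] at h
        linarith
      · have h := dec_le 0 {0} (fun J => 0 ∈ J ∧ 1 ∉ J ∧ 2 ∉ J)
          (by simpa using h0) (by simp)
          (fun J hJ h => ⟨mem_of_inter_singleton_nonempty h,
            fun hm => by simpa [h1D, hA] using hJ hm, fun hm => by simpa [h2D, hA] using hJ hm⟩)
        have h3 := sum_filter_add_le hγ0 (fun J => 0 ∈ J ∧ 1 ∉ J ∧ 2 ∉ J) (fun J => 1 ∈ J)
          (fun J => 2 ∈ J) (fun J => (J ∩ {0, 1, 2}).Nonempty ∧ ¬ J ⊆ fifteenSenders.A 0)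
          (fun J => 1 ∈ J ∧ 2 ∈ J) (by decide)
        rw [Finset.sum_singleton] at h
        linarith

/-! ### Decomposition of the polytope over six vertices -/

/-- The maximal vertices of the closed polytope. -/
def vertexRate : Fin 6 → Fin 4 → ℕ :=
  ![![4, 8, 4, 8], ![4, 8, 6, 6], ![2, 8, 8, 4], ![4, 6, 8, 4], ![6, 6, 6, 6], ![8, 4, 4, 4]]

/-- Every point of the closed polytope is dominated by a convex combination of the vertices. -/
lemma exists_weights_of_mem_closedPolytope {R : Fin 4 → ℝ} (hR : R ∈ closedPolytope) :
    ∃ w : Fin 6 → ℝ, (∀ v, 0 ≤ w v) ∧ ∑ v, w v = 1 ∧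
      ∀ i, R i ≤ ∑ v, w v * (vertexRate v i : ℝ) := by
  obtain ⟨h0, h8, h01, h02, h03, h23, h012⟩ := hR
  have g0 := h8 0
  have g1 := h8 1
  have g2 := h8 2
  have g3 := h8 3
  have key : ∀ w : Fin 6 → ℝ, (∀ v, 0 ≤ w v) → w 0 + w 1 + w 2 + w 3 + w 4 + w 5 = 1 →
      R 0 ≤ 4 * w 0 + 4 * w 1 + 2 * w 2 + 4 * w 3 + 6 * w 4 + 8 * w 5 →
      R 1 ≤ 8 * w 0 + 8 * w 1 + 8 * w 2 + 6 * w 3 + 6 * w 4 + 4 * w 5 →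
      R 2 ≤ 4 * w 0 + 6 * w 1 + 8 * w 2 + 8 * w 3 + 6 * w 4 + 4 * w 5 →
      R 3 ≤ 8 * w 0 + 6 * w 1 + 4 * w 2 + 4 * w 3 + 6 * w 4 + 4 * w 5 →
      ∃ w : Fin 6 → ℝ, (∀ v, 0 ≤ w v) ∧ ∑ v, w v = 1 ∧
        ∀ i, R i ≤ ∑ v, w v * (vertexRate v i : ℝ) := by
    intro w hw hs e0 e1 e2 e3
    refine ⟨w, hw, by simpa [Fin.sum_univ_six] using hs, ?_⟩
    intro i
    fin_cases i <;> simp [Fin.sum_univ_six, vertexRate] <;> linarith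
  -- Vertices 1, 2, 3, 4 form a parallelogram, so the bilinear weights in `s`, `t` give an affine
  -- map. It reproduces `R 0` and `R 2` and attains the bounds `18 - R 0 - R 2` on `R 1` and `12 - R
  -- 2` on `R 3`.
  have corner : 10 ≤ R 0 + R 2 → 6 ≤ R 2 → ∃ w : Fin 6 → ℝ, (∀ v, 0 ≤ w v) ∧ ∑ v, w v = 1 ∧
      ∀ i, R i ≤ ∑ v, w v * (vertexRate v i : ℝ) := by
    intro hs hz
    obtain ⟨s, es⟩ : ∃ s, s = (R 0 + R 2 - 10) / 2 := ⟨_, rfl⟩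
    obtain ⟨t, et⟩ : ∃ t, t = (R 2 - 6) / 2 := ⟨_, rfl⟩
    have hs0 : 0 ≤ s := by linarith
    have hs1 : 0 ≤ 1 - s := by linarith
    have ht0 : 0 ≤ t := by linarith
    have ht1 : 0 ≤ 1 - t := by linarith
    refine key ![0, (1 - s) * (1 - t), (1 - s) * t, s * t, s * (1 - t), 0] ?_ ?_ ?_ ?_ ?_ ?_
    · simp only [Fin.forall_fin_succ]
      simp
      exact ⟨by positivity, by positivity, by positivity, by positivity⟩
    · simp; ring
    all_goals simp; linarith
  -- The largest admissible `R 1` and `R 3` are concave and piecewise linear in `(R 0, R 2)`. The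
  -- cases follow their breaks, and the weights interpolate between the vertices of each piece.
  rcases le_total (R 0) 4 with hx | hx
  · rcases le_total (R 2) 4 with hz | hz
    · refine key ![1, 0, 0, 0, 0, 0] ?_ ?_ ?_ ?_ ?_ ?_
      · simp [Fin.forall_fin_succ]
      all_goals simp <;> linarith
    · rcases le_total (R 0 + R 2) 10 with hs | hs
      · rcases le_total (R 2) 6 with hz6 | hz6
        · refine key ![(6 - R 2) / 2, (R 2 - 4) / 2, 0, 0, 0, 0] ?_ ?_ ?_ ?_ ?_ ?_
          · simp [Fin.forall_fin_succ]; constructor <;> linarith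
          all_goals simp; linarith
        · refine key ![0, (8 - R 2) / 2, (R 2 - 6) / 2, 0, 0, 0] ?_ ?_ ?_ ?_ ?_ ?_
          · simp [Fin.forall_fin_succ]; constructor <;> linarith
          all_goals simp; linarith
      · exact corner hs (by linarith)
  · rcases le_total 6 (R 2) with hz | hz
    · exact corner (by linarith) hz
    · rcases le_total (R 2) (R 0) with hxz | hxz
      · rcases le_total (R 0) 6 with hx6 | hx6
        · refine key ![(6 - R 0) / 2, 0, 0, 0, (R 0 - 4) / 2, 0] ?_ ?_ ?_ ?_ ?_ ?_
          · simp [Fin.forall_fin_succ]; constructor <;> linarith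
          all_goals simp; linarith
        · refine key ![0, 0, 0, 0, (8 - R 0) / 2, (R 0 - 6) / 2] ?_ ?_ ?_ ?_ ?_ ?_
          · simp [Fin.forall_fin_succ]; constructor <;> linarith
          all_goals simp; linarith
      · refine key ![(6 - R 2) / 2, (R 2 - R 0) / 2, 0, 0, (R 0 - 4) / 2, 0] ?_ ?_ ?_ ?_ ?_ ?_
        · simp [Fin.forall_fin_succ]; refine ⟨?_, ?_, ?_⟩ <;> linarith
        all_goals simp; linarith

/-- Every point of the open polytope is strictly dominated by a combination of the vertices with
total weight less than one. -/
lemma exists_weights_of_mem_openPolytope {R : Fin 4 → ℝ} (hR : R ∈ openPolytope) :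
    ∃ w : Fin 6 → ℝ, (∀ v, 0 ≤ w v) ∧ ∑ v, w v < 1 ∧
      ∀ i, R i < ∑ v, w v * (vertexRate v i : ℝ) := by
  obtain ⟨h0, h8, h01, h02, h03, h23, h012⟩ := hR
  -- Adding `d` to each of `s` coordinates and dividing by `1 - d` preserves a bound `c` when `(s +
  -- c) * d` is at most the slack; the worst case is `3 + 18 = 21`.
  obtain ⟨d, hd, hd1, hd8, hd01, hd02, hd03, hd23, hd012⟩ : ∃ d : ℝ, 0 < d ∧ d < 1 ∧
      (∀ j, d < (8 - R j) / 21) ∧ d < (12 - (R 0 + R 1)) / 21 ∧ d < (12 - (R 0 + R 2)) / 21 ∧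
      d < (12 - (R 0 + R 3)) / 21 ∧ d < (12 - (R 2 + R 3)) / 21 ∧
      d < (18 - (R 0 + R 1 + R 2)) / 21 := by
    have ev : ∀ c : ℝ, 0 < c → ∀ᶠ d in 𝓝[>] (0 : ℝ), d < c := fun c hc =>
      eventually_nhdsWithin_of_eventually_nhds (eventually_lt_nhds hc)
    exact (eventually_mem_nhdsWithin.and ((ev 1 one_pos).and
      ((eventually_all.2 fun j => ev _ (by have := h8 j; linarith)).and
      ((ev _ (by linarith)).and ((ev _ (by linarith)).and ((ev _ (by linarith)).and
      ((ev _ (by linarith)).and (ev _ (by linarith))))))))).exists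
  have hd' : 0 < 1 - d := by linarith
  obtain ⟨w, hw, hs, hle⟩ := exists_weights_of_mem_closedPolytope
    (R := fun i => (R i + d) / (1 - d)) (by
      refine ⟨fun j => div_nonneg (by have := h0 j; linarith) hd'.le, fun j => ?_, ?_, ?_, ?_, ?_,
        ?_⟩
      · have := hd8 j
        rw [div_le_iff₀ hd']
        linarith
      all_goals
        simp only [← add_div]
        rw [div_le_iff₀ hd']
        linarith)
  refine ⟨fun v => (1 - d) * w v, fun v => mul_nonneg hd'.le (hw v), ?_, fun i => ?_⟩
  · rw [← Finset.mul_sum, hs]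
    linarith
  · have := hle i
    rw [div_le_iff₀ hd'] at this
    simp only [mul_assoc]
    rw [← Finset.mul_sum]
    linarith

/-! ### Composite coding: inner bound at the vertices -/

/-- The positive composite rates at each vertex. -/
def vertexCompositeList : Fin 6 → List (Finset (Fin 4) × ℕ) :=
  ![[({0}, 2), ({1}, 1), ({0, 1}, 1), ({2}, 2), ({1, 2}, 1), ({0, 1, 2}, 1), ({3}, 2), ({0, 3}, 2), ({1, 3}, 4)],
    [({0}, 2), ({1}, 1), ({0, 1}, 1), ({2}, 2), ({1, 2}, 3), ({0, 1, 2}, 1), ({3}, 2), ({0, 3}, 2), ({1, 3}, 2)],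
    [({0}, 1), ({1}, 2), ({2}, 3), ({0, 2}, 1), ({1, 2}, 4), ({3}, 1), ({0, 3}, 1), ({1, 3}, 2)],
    [({0}, 2), ({1}, 1), ({2}, 2), ({0, 2}, 1), ({1, 2}, 4), ({3}, 1), ({0, 3}, 2), ({1, 3}, 1), ({2, 3}, 1)],
    [({0}, 3), ({1}, 1), ({2}, 2), ({1, 2}, 1), ({0, 1, 2}, 1), ({3}, 2), ({0, 3}, 3), ({1, 3}, 1), ({1, 2, 3}, 1), ({0, 1, 2, 3}, 1)],
    [({0}, 6), ({1}, 1), ({2}, 1), ({1, 2}, 1), ({3}, 1), ({0, 3}, 2), ({1, 3}, 1), ({2, 3}, 1), ({1, 2, 3}, 1)]]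

/-- The composite rates at each vertex. -/
def vertexComposite (v : Fin 6) (J : Finset (Fin 4)) : ℕ :=
  ((vertexCompositeList v).lookup J).getD 0

/-- The composite that each sender carries for each receiver, at each vertex. -/
def vertexAssignment : Fin 6 → Fin 4 → Fin 15 → Finset (Fin 4) :=
  ![![![{0}, {1}, {2}, ∅, {0, 1}, {0}, {2}, {1, 2}, {1, 3}, {0, 3}, {0, 1, 2}, {1, 3}, {0, 3}, {1, 3}, {1, 3}],
      ![{0}, {1}, ∅, ∅, {0, 1}, {0}, ∅, {1, 2}, {1, 3}, {0, 3}, {0, 1, 2}, {1, 3}, {0, 3}, {1, 3}, {1, 3}],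
      ![∅, ∅, {2}, {3}, ∅, {2}, {3}, {1, 2}, {1, 3}, {0, 3}, {0, 1, 2}, {1, 3}, {0, 3}, {1, 3}, {1, 3}],
      ![{0}, ∅, ∅, {3}, {0, 1}, {0}, {3}, ∅, {1, 3}, {0, 3}, {0, 1, 2}, {1, 3}, {0, 3}, {1, 3}, {1, 3}]],
    ![![{0}, {1}, {2}, ∅, {0, 1}, {0}, {2}, {1, 2}, {1, 3}, {0, 3}, {0, 1, 2}, {1, 3}, {0, 3}, {1, 2}, {1, 2}],
      ![{0}, {1}, ∅, ∅, {0, 1}, {0}, ∅, {1, 2}, {1, 3}, {0, 3}, {0, 1, 2}, {1, 3}, {0, 3}, {1, 2}, {1, 2}],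
      ![∅, ∅, {2}, {3}, ∅, {2}, {3}, {1, 2}, {1, 3}, {0, 3}, {0, 1, 2}, {1, 3}, {0, 3}, {1, 2}, {1, 2}],
      ![{0}, ∅, ∅, {3}, {0, 1}, {0}, ∅, ∅, {1, 3}, {0, 3}, {0, 1, 2}, {1, 3}, {0, 3}, {3}, ∅]],
    ![![{0}, {1}, {2}, {3}, {1}, {0, 2}, {2}, {1, 2}, {1, 3}, {0, 3}, {1, 2}, {1, 3}, {2}, {1, 2}, {1, 2}],
      ![{0}, {1}, {2}, {3}, {1}, {0, 2}, {2}, {1, 2}, {1, 3}, {0, 3}, {1, 2}, {1, 3}, {2}, {1, 2}, {1, 2}],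
      ![{0}, {1}, {2}, {3}, {1}, {0, 2}, {2}, {1, 2}, {1, 3}, {0, 3}, {1, 2}, {1, 3}, {2}, {1, 2}, {1, 2}],
      ![{0}, {1}, {2}, {3}, {1}, {0, 2}, {2}, {1, 2}, {1, 3}, {0, 3}, {1, 2}, {1, 3}, {2}, {1, 2}, {1, 2}]],
    ![![{0}, {1}, {2}, {3}, {0}, {2}, {2, 3}, {1, 2}, {1, 3}, {0, 3}, {1, 2}, {0, 3}, {0, 2}, {1, 2}, {1, 2}],
      ![{0}, {1}, {2}, {3}, {0}, {2}, {2, 3}, {1, 2}, {1, 3}, {0, 3}, {1, 2}, {0, 3}, {0, 2}, {1, 2}, {1, 2}],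
      ![{0}, {1}, {2}, {3}, {0}, {2}, {2, 3}, {1, 2}, {1, 3}, {0, 3}, {1, 2}, {0, 3}, {0, 2}, {1, 2}, {1, 2}],
      ![{0}, {1}, {2}, {3}, {0}, {2}, {2, 3}, {1, 2}, {1, 3}, {0, 3}, {1, 2}, {0, 3}, {0, 2}, {1, 2}, {1, 2}]],
    ![![{0}, {1}, {2}, ∅, {0}, {0}, {2}, {1, 2}, {1, 3}, {0, 3}, {0, 1, 2}, {0, 3}, {0, 3}, {1, 2, 3}, {0, 1, 2, 3}],
      ![{0}, {1}, ∅, ∅, {0}, {0}, ∅, {1, 2}, {1, 3}, {0, 3}, {0, 1, 2}, {0, 3}, {0, 3}, {1, 2, 3}, {0, 1, 2, 3}],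
      ![∅, ∅, {2}, {3}, ∅, {2}, {3}, {1, 2}, {1, 3}, {0, 3}, {0, 1, 2}, {0, 3}, {0, 3}, {1, 2, 3}, {0, 1, 2, 3}],
      ![{0}, ∅, ∅, {3}, {0}, {0}, {3}, ∅, {1, 3}, {0, 3}, {0, 1, 2}, {0, 3}, {0, 3}, {1, 2, 3}, {0, 1, 2, 3}]],
    ![![{0}, {1}, {2}, {3}, {0}, {0}, {2, 3}, {1, 2}, {1, 3}, {0}, {0}, {0, 3}, {0, 3}, {1, 2, 3}, {0}],
      ![{0}, {1}, {2}, {3}, {0}, {0}, {2, 3}, {1, 2}, {1, 3}, {0}, {0}, {0, 3}, {0, 3}, {1, 2, 3}, {0}],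
      ![{0}, {1}, {2}, {3}, {0}, {0}, {2, 3}, {1, 2}, {1, 3}, {0}, {0}, {0, 3}, {0, 3}, {1, 2, 3}, {0}],
      ![{0}, {1}, {2}, {3}, {0}, {0}, {2, 3}, {1, 2}, {1, 3}, {0}, {0}, {0, 3}, {0, 3}, {1, 2, 3}, {0}]]]

lemma vertexAssignment_subset (v : Fin 6) (j : Fin 4) (k : Fin 15) :
    vertexAssignment v j k ⊆ fifteenSenders.S k := by
  revert v j k
  decide +kernel

/-- Only composites unknown to receiver `j` need senders, so the assignment may depend on `j`. This
is needed: at vertex 0 the composite rates add up to 16, more than the fifteen unit links. -/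
lemma vertexComposite_le_card (v : Fin 6) (j : Fin 4) (J : Finset (Fin 4))
    (hJ : ¬ J ⊆ fifteenSenders.A j) :
    vertexComposite v J ≤ (Finset.univ.filter fun k => vertexAssignment v j k = J).card := by
  revert v j J
  decide +kernel

lemma vertexRate_le_vertexComposite (v : Fin 6) (j : Fin 4) (T : Finset (Fin 4))
    (hT : T ⊆ fifteenSendersChoice j) :
    ∑ i ∈ T, vertexRate v i ≤
      ∑ J : Finset (Fin 4) with
        J ⊆ fifteenSendersChoice j ∪ fifteenSenders.A j ∧ (J ∩ T).Nonempty, vertexComposite v J := by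
  revert v j T
  decide +kernel

/-- The assignment replaces a check of all sets `Q`: if `J` fits into no sender outside `Q`, every
sender assigned `J` lies in `Q`, and each sender is assigned one composite. -/
lemma vertexComposite_sum_le (v : Fin 6) (j : Fin 4) (Q : Finset (Fin 15)) :
    ∑ J : Finset (Fin 4) with
      (∃ k ∈ Q, J ⊆ fifteenSenders.S k) ∧ ¬ (∃ k ∈ Qᶜ, J ⊆ fifteenSenders.S k) ∧
        ¬ J ⊆ fifteenSenders.A j, vertexComposite v J ≤ Q.card := by
  rw [Finset.card_eq_sum_card_fiberwise (f := vertexAssignment v j) (t := Finset.univ) (by simp)]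
  refine (Finset.sum_le_sum fun J hJ => ?_).trans
    (Finset.sum_le_sum_of_subset (Finset.filter_subset _ _))
  simp only [Finset.mem_filter, Finset.mem_univ, true_and] at hJ
  refine (vertexComposite_le_card v j J hJ.2.2).trans (Finset.card_le_card fun k hk => ?_)
  simp only [Finset.mem_filter, Finset.mem_univ, true_and] at hk ⊢
  refine ⟨by_contra fun hkQ => hJ.2.1 ⟨k, by simpa using hkQ, ?_⟩, hk⟩
  exact hk ▸ vertexAssignment_subset v j k

/-- The CCC region of the distinguished decoding choice contains the open polytope. -/
lemma openPolytope_subset_cccRegionOf :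
    openPolytope ⊆ cccRegionOf fifteenSenders fifteenSendersChoice := by
  intro R hR
  obtain ⟨w, hw, hs, hlt⟩ := exists_weights_of_mem_openPolytope hR
  refine ⟨hR.1, fun J => ∑ v, w v * (vertexComposite v J : ℝ), fun k J _ =>
    Finset.sum_nonneg fun v _ => mul_nonneg (hw v) (Nat.cast_nonneg _), ?_, ?_⟩
  · intro j T hT hne
    refine (Finset.sum_lt_sum_of_nonempty hne fun i _ => hlt i).trans_le ?_
    rw [Finset.sum_comm, Finset.sum_comm (t := Finset.univ)]
    refine Finset.sum_le_sum fun v _ => ?_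
    rw [← Finset.mul_sum, ← Finset.mul_sum]
    refine mul_le_mul_of_nonneg_left ?_ (hw v)
    have h := vertexRate_le_vertexComposite v j T hT
    have e : ∀ J : Finset (Fin 4), ∃ k, J ⊆ fifteenSenders.S k := fun J => ⟨14, subset_sender J⟩
    simp only [e, true_and]
    exact_mod_cast h
  · intro j Q hQ
    have hQ' : (0 : ℝ) < Q.card := by exact_mod_cast hQ.card_pos
    rw [Finset.sum_comm]
    calc _ ≤ ∑ v, w v * (Q.card : ℝ) := by
          refine Finset.sum_le_sum fun v _ => ?_
          rw [← Finset.mul_sum]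
          refine mul_le_mul_of_nonneg_left ?_ (hw v)
          exact_mod_cast vertexComposite_sum_le v j Q
      _ = (∑ v, w v) * Q.card := by rw [Finset.sum_mul]
      -- The vertex inequalities are not strict; strictness comes from total weight less than one.
      _ < Q.card := by nlinarith
      _ = _ := by simp [fifteenSenders]

/-! ### Converse: counting tools -/

section Converse

variable {N K : ℕ} {P : Problem N K} {R : Fin N → ℝ} {n : ℕ}

lemma msgSize_pos (n : ℕ) (r : ℝ) : 0 < msgSize n r := by unfold msgSize; positivity

instance (n : ℕ) (r : ℝ) : NeZero (msgSize n r) := ⟨(msgSize_pos n r).ne'⟩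

instance (n : ℕ) (c : ℝ) : NeZero (linkSize n c) := ⟨by unfold linkSize; positivity⟩

/-- The message tuples that all receivers estimate correctly. -/
noncomputable def Code.correct (c : Code P R n) : Finset (Messages R n) :=
  Finset.univ.filter fun m => c.estimate m = m

/-- Takes the role of Fano's inequality: on the correct tuples decodability is exact. -/
lemma Code.eq_of_links_eq (c : Code P R n) {m m' : Messages R n} (hm : m ∈ c.correct)
    (hm' : m' ∈ c.correct) (hl : c.links m = c.links m') (j : Fin N)
    (hA : ∀ i ∈ P.A j, m i = m' i) : m j = m' j := by
  simp only [Code.correct, Finset.mem_filter, Finset.mem_univ, true_and] at hm hm'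
  rw [← congrFun hm j, ← congrFun hm' j]
  unfold Code.estimate
  rw [hl]
  congr 1
  funext i
  exact hA i i.2

lemma Code.link_congr (c : Code P R n) {m m' : Messages R n} {k : Fin K}
    (h : ∀ i ∈ P.S k, m i = m' i) : c.links m k = c.links m' k := by
  unfold Code.links
  congr 1
  funext i
  exact h i i.2

lemma card_messages : Fintype.card (Messages R n) = ∏ i, msgSize n (R i) := by
  simp [Messages, Fintype.card_pi]

lemma Code.three_mul_le_of_errorProb_lt (c : Code P R n) (h : c.errorProb < 1 / 4) :
    3 * ∏ i, msgSize n (R i) ≤ 4 * c.correct.card := by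
  classical
  have hpos : (0 : ℝ) < Nat.card (Messages R n) := by
    rw [Nat.card_eq_fintype_card]
    exact_mod_cast Fintype.card_pos
  rw [Code.errorProb, div_lt_iff₀ hpos, Nat.card_eq_fintype_card, Nat.card_eq_fintype_card,
    Fintype.card_subtype] at h
  have h2 := Finset.card_filter_add_card_filter_not (s := (Finset.univ : Finset (Messages R n)))
    (fun m => c.estimate m = m)
  rw [Finset.card_univ] at h2
  simp only [ne_eq] at h
  rw [← card_messages]
  change _ ≤ 4 * (Finset.univ.filter fun m => c.estimate m = m).card
  have h3 : 4 * (Finset.univ.filter fun m => ¬ c.estimate m = m).card <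
      Fintype.card (Messages R n) := by
    have : 4 * ((Finset.univ.filter fun m => ¬ c.estimate m = m).card : ℝ) <
      Fintype.card (Messages R n) := by linarith
    exact_mod_cast this
  omega

/-- Counting message tuples by some messages and some links. -/
lemma Code.card_le_mul (c : Code P R n) (G : Finset (Messages R n)) (W : Finset (Fin N))
    (Q : Finset (Fin K)) (b : ℕ)
    (h : ∀ g ∈ G, (G.filter fun m =>
      (∀ i ∈ W, m i = g i) ∧ ∀ k ∈ Q, c.links m k = c.links g k).card ≤ b) :
    G.card ≤ b * ((∏ i ∈ W, msgSize n (R i)) * ∏ k ∈ Q, linkSize n (P.C k)) := by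
  classical
  let f : Messages R n → (∀ i : W, Fin (msgSize n (R i))) × (∀ k : Q, Fin (linkSize n (P.C k))) :=
    fun m => (fun i => m i, fun k => c.links m k)
  have hf : ∀ m g, f m = f g ↔
      (∀ i ∈ W, m i = g i) ∧ ∀ k ∈ Q, c.links m k = c.links g k := by
    intro m g
    simp [f, Prod.ext_iff, funext_iff]
  have h1 : G.card ≤ b * (G.image f).card := by
    refine Finset.card_le_mul_card_image _ _ fun y hy => ?_
    obtain ⟨g, hg, rfl⟩ := Finset.mem_image.1 hy
    refine le_of_eq_of_le ?_ (h g hg)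
    simp only [hf]
  refine h1.trans (Nat.mul_le_mul_left _ ((Finset.card_le_univ _).trans_eq ?_))
  rw [Fintype.card_prod, Fintype.card_pi, Fintype.card_pi]
  simp only [Fintype.card_fin]
  rw [Finset.prod_coe_sort W (fun i => msgSize n (R i)),
    Finset.prod_coe_sort Q (fun k => linkSize n (P.C k))]

/-- The elements of a set whose fibre is mostly outside the set make up at most half of the
ambient type. -/
lemma two_mul_card_sparse_le {X Y : Type*} [Fintype X] [DecidableEq X] [DecidableEq Y]
    (f : X → Y) (G : Finset X) :
    2 * (G.filter fun g => 2 * (G.filter fun x => f x = f g).card <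
      (Finset.univ.filter fun x => f x = f g).card).card ≤ Fintype.card X := by
  set B := G.filter fun g => 2 * (G.filter fun x => f x = f g).card <
      (Finset.univ.filter fun x => f x = f g).card with hB
  rw [Finset.card_eq_sum_card_fiberwise (s := B) (t := Finset.univ.image f) (f := f)
      (fun x _ => by simp), ← Finset.card_univ,
    Finset.card_eq_sum_card_fiberwise (s := Finset.univ) (t := Finset.univ.image f) (f := f)
      (fun x _ => by simp), Finset.mul_sum]
  refine Finset.sum_le_sum fun y _ => ?_
  rcases (B.filter fun x => f x = y).eq_empty_or_nonempty with h | ⟨g, hg⟩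
  · simp [h]
  · obtain ⟨hgB, rfl⟩ := Finset.mem_filter.1 hg
    rw [hB] at hgB
    have h1 := (Finset.mem_filter.1 hgB).2
    refine le_trans (Nat.mul_le_mul_left 2 (Finset.card_le_card ?_)) h1.le
    exact Finset.filter_subset_filter _ (Finset.filter_subset _ _)

/-- A bound on the number of values of some messages at all large block lengths bounds the sum of
their rates. -/
lemma sum_rate_le_of_prod_msgSize_le (V : Finset (Fin N)) (a q : ℕ)
    (h : ∀ᶠ n in atTop, ∏ i ∈ V, msgSize n (R i) ≤ 2 ^ (a + q * n)) :
    ∑ i ∈ V, R i ≤ q := by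
  have h1 : ∀ᶠ n : ℕ in atTop, ∑ i ∈ V, R i ≤ a / (n : ℝ) + q := by
    filter_upwards [h, eventually_gt_atTop 0] with n hn hn0
    have hn0' : (0 : ℝ) < n := by exact_mod_cast hn0
    simp only [msgSize] at hn
    rw [Finset.prod_pow_eq_pow_sum, Nat.pow_le_pow_iff_right (by norm_num)] at hn
    have h2 : (n : ℝ) * ∑ i ∈ V, R i ≤ a + q * n := by
      rw [Finset.mul_sum]
      calc _ ≤ ∑ i ∈ V, (⌈(n : ℝ) * R i⌉₊ : ℝ) := Finset.sum_le_sum fun i _ => Nat.le_ceil _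
        _ ≤ _ := by exact_mod_cast hn
    rw [div_add' _ _ _ hn0'.ne', le_div_iff₀ hn0']
    linarith
  have h2 : Tendsto (fun n : ℕ => (a : ℝ) / n + q) atTop (𝓝 (0 + q)) :=
    (tendsto_const_div_atTop_nhds_zero_nat _).add_const _
  rw [zero_add] at h2
  exact ge_of_tendsto h2 h1

end Converse

/-! ### Converse: the bounds for the instance -/

section FifteenSenders

variable {R : Fin 4 → ℝ} {n : ℕ}

lemma linkSize_fifteenSenders (k : Fin 15) : linkSize n (fifteenSenders.C k) = 2 ^ n := by
  simp [linkSize, fifteenSenders]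

/-- Two messages, the first of which is not decoded with the help of the second, are determined
by the links that depend on them. -/
lemma prod_msgSize_pair_le (c : Code fifteenSenders R n) (h : c.errorProb < 1 / 4) (u v : Fin 4)
    (huv : v ∉ fifteenSenders.A u) (q : ℕ)
    (hq : (Finset.univ.filter fun k => (fifteenSenders.S k ∩ {u, v}).Nonempty).card = q) :
    ∏ i ∈ {u, v}, msgSize n (R i) ≤ 2 ^ (1 + q * n) := by
  have h1 := c.three_mul_le_of_errorProb_lt h
  have h2 := c.card_le_mul c.correct ({u, v} : Finset (Fin 4))ᶜ
    (Finset.univ.filter fun k => (fifteenSenders.S k ∩ {u, v}).Nonempty) 1 (by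
      intro g hg
      rw [Finset.card_le_one_iff_subset_singleton]
      refine ⟨g, fun m hm => ?_⟩
      simp only [Finset.mem_filter, Finset.mem_compl, Finset.mem_univ, true_and] at hm
      obtain ⟨hmG, hW, hQ⟩ := hm
      have hl : c.links m = c.links g := by
        funext k
        by_cases hk : (fifteenSenders.S k ∩ {u, v}).Nonempty
        · exact hQ k hk
        · refine c.link_congr fun i hi => hW i fun hi' => hk ⟨i, Finset.mem_inter.2 ⟨hi, hi'⟩⟩
      have hu : m u = g u := by
        refine c.eq_of_links_eq hmG hg hl u fun i hi => hW i ?_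
        simp only [Finset.mem_insert, Finset.mem_singleton, not_or]
        exact ⟨fun e => fifteenSenders.not_mem_A u (e ▸ hi), fun e => huv (e ▸ hi)⟩
      have hv : m v = g v := by
        refine c.eq_of_links_eq hmG hg hl v fun i hi => ?_
        by_cases hiu : i = u
        · exact hiu ▸ hu
        · refine hW i ?_
          simp only [Finset.mem_insert, Finset.mem_singleton, not_or]
          exact ⟨hiu, fun e => fifteenSenders.not_mem_A v (e ▸ hi)⟩
      rw [Finset.mem_singleton]
      funext i
      by_cases hi : i ∈ ({u, v} : Finset (Fin 4))
      · rcases Finset.mem_insert.1 hi with rfl | hi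
        · exact hu
        · rw [Finset.mem_singleton.1 hi]
          exact hv
      · exact hW i hi)
  simp only [linkSize_fifteenSenders, Finset.prod_const, hq, one_mul, ← pow_mul] at h2
  rw [← Finset.prod_mul_prod_compl ({u, v} : Finset (Fin 4))] at h1
  have hpos : 0 < ∏ i ∈ ({u, v} : Finset (Fin 4))ᶜ, msgSize n (R i) :=
    Finset.prod_pos fun i _ => msgSize_pos n _
  have h3 : 3 * ∏ i ∈ {u, v}, msgSize n (R i) ≤ 4 * 2 ^ (n * q) := by
    refine Nat.le_of_mul_le_mul_right ?_ hpos
    calc _ = _ := by rw [mul_assoc]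
      _ ≤ _ := h1
      _ ≤ _ := Nat.mul_le_mul_left 4 h2
      _ = _ := by ring
  -- The loss `4 / 3` from decoding errors is rounded up to one extra bit.
  rw [pow_add, mul_comm q]
  omega

/-- The links that do not carry a function of the messages `1` and `2` jointly. -/
def separateLinks : Finset (Fin 15) :=
  Finset.univ.filter fun k => ¬ {1, 2} ⊆ fifteenSenders.S k

/-- The three messages `0`, `1`, `2` satisfy a bound that is not of cut-set type. -/
lemma prod_msgSize_triple_le (c : Code fifteenSenders R n) (h : c.errorProb < 1 / 4) :
    ∏ i ∈ {0, 1, 2}, msgSize n (R i) ≤ 2 ^ (3 + 18 * n) := by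
  classical
  have h1 := c.three_mul_le_of_errorProb_lt h
  set G := c.correct
  -- The cells of `f` stand for conditioning on messages 0, 3 and the separate links. `G'` keeps the
  -- correct tuples whose cell consists at least half of correct tuples.
  let f : Messages R n → Fin (msgSize n (R 0)) × Fin (msgSize n (R 3)) ×
      (∀ k : separateLinks, Fin (linkSize n (fifteenSenders.C k))) :=
    fun m => (m 0, m 3, fun k => c.links m k)
  have hf : ∀ m g, f m = f g ↔
      m 0 = g 0 ∧ m 3 = g 3 ∧ ∀ k ∈ separateLinks, c.links m k = c.links g k := by
    intro m g
    simp [f, Prod.ext_iff, funext_iff]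
  have hbad := two_mul_card_sparse_le f G
  have hsplit := Finset.card_filter_add_card_filter_not (s := G) (fun g =>
    2 * (G.filter fun x => f x = f g).card < (Finset.univ.filter fun x => f x = f g).card)
  rw [card_messages] at hbad
  set G' := G.filter fun g => ¬ 2 * (G.filter fun x => f x = f g).card <
    (Finset.univ.filter fun x => f x = f g).card
  have hlinks : ∀ m g, f m = f g → (∀ k ∉ separateLinks, c.links m k = c.links g k) →
      c.links m = c.links g := by
    intro m g hmg hk
    funext k
    by_cases hks : k ∈ separateLinks
    · exact ((hf m g).1 hmg).2.2 k hks
    · exact hk k hks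
  have hupd1 : ∀ m g : Messages R n, f m = f g → f (Function.update g 1 (m 1)) = f g := by
    intro m g hmg
    obtain ⟨h0, h3, hk⟩ := (hf m g).1 hmg
    refine (hf _ _).2 ⟨by simp, by simp, fun k hks => ?_⟩
    by_cases hk1 : 1 ∈ fifteenSenders.S k
    · rw [← hk k hks]
      have hk2 : 2 ∉ fifteenSenders.S k := fun hk2 =>
        (Finset.mem_filter.1 hks).2 (by simp [Finset.insert_subset_iff, hk1, hk2])
      refine c.link_congr fun i hi => ?_
      fin_cases i
      · exact h0.symm
      · simp
      · exact absurd hi hk2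
      · exact h3.symm
    · refine c.link_congr fun i hi => ?_
      rw [Function.update_of_ne]
      exact fun e => hk1 (e ▸ hi)
  have hupd2 : ∀ m g : Messages R n, f m = f g → f (Function.update g 2 (m 2)) = f g := by
    intro m g hmg
    obtain ⟨h0, h3, hk⟩ := (hf m g).1 hmg
    refine (hf _ _).2 ⟨by simp, by simp, fun k hks => ?_⟩
    by_cases hk2 : 2 ∈ fifteenSenders.S k
    · rw [← hk k hks]
      have hk1 : 1 ∉ fifteenSenders.S k := fun hk1 =>
        (Finset.mem_filter.1 hks).2 (by simp [Finset.insert_subset_iff, hk1, hk2])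
      refine c.link_congr fun i hi => ?_
      fin_cases i
      · exact h0.symm
      · exact absurd hi hk1
      · simp
      · exact h3.symm
    · refine c.link_congr fun i hi => ?_
      rw [Function.update_of_ne]
      exact fun e => hk2 (e ▸ hi)
  have hsep : (separateLinksᶜ).card = 4 := by decide
  -- The first `{3}` is a message, the second a sender: sender 3 has only message 3, so fourteen
  -- links remain.
  have hmain := c.card_le_mul G' {3} {3}ᶜ (2 * 2 ^ (4 * n)) (by
    intro g hg
    obtain ⟨hgG, hdense⟩ := Finset.mem_filter.1 hg
    rw [not_lt] at hdense
    set A : Finset (Fin (msgSize n (R 1))) :=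
      Finset.univ.filter fun a => f (Function.update g 1 a) = f g with hA
    set B : Finset (Fin (msgSize n (R 2))) :=
      Finset.univ.filter fun b => f (Function.update g 2 b) = f g
    -- Conditional independence: within a cell no separate link sees both 1 and 2, so these two
    -- coordinates can be changed independently. The new tuples need not be correct, hence the whole
    -- cell on the right.
    have hAB : A.card * B.card ≤ (Finset.univ.filter fun x => f x = f g).card := by
      rw [← Finset.card_product]
      refine Finset.card_le_card_of_injOn
        (fun p => Function.update (Function.update g 1 p.1) 2 p.2) ?_ ?_
      · rintro ⟨a, b⟩ hp
        obtain ⟨ha, hb⟩ := Finset.mem_product.1 hp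
        have ha' := (hf _ _).1 (Finset.mem_filter.1 ha).2
        have hb' := (hf _ _).1 (Finset.mem_filter.1 hb).2
        refine Finset.mem_coe.2 (Finset.mem_filter.2 ⟨Finset.mem_univ _, (hf _ _).2
          ⟨by simp, by simp, fun k hk => ?_⟩⟩)
        by_cases hk2 : 2 ∈ fifteenSenders.S k
        · have hk1 : 1 ∉ fifteenSenders.S k := fun hk1 =>
            (Finset.mem_filter.1 hk).2 (by simp [Finset.insert_subset_iff, hk1, hk2])
          rw [← hb'.2.2 k hk]
          refine c.link_congr fun i hi => ?_
          have hi1 : i ≠ 1 := fun e => hk1 (e ▸ hi)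
          by_cases hi2 : i = 2
          · subst hi2
            simp
          · simp [Function.update_of_ne hi2, Function.update_of_ne hi1]
        · rw [← ha'.2.2 k hk]
          refine c.link_congr fun i hi => ?_
          rw [Function.update_of_ne]
          exact fun e => hk2 (e ▸ hi)
      · rintro ⟨a, b⟩ - ⟨a', b'⟩ - hp
        have e1 : a = a' := by simpa using congrFun hp 1
        have e2 : b = b' := by simpa using congrFun hp 2
        rw [e1, e2]
    -- Receiver 2 knows messages 0 and 1, so message 1 and the four joint links determine a correct
    -- tuple of the cell.
    have hcell : (G.filter fun x => f x = f g).card ≤ A.card * 2 ^ (4 * n) := by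
      have hcard : (Finset.univ : Finset (∀ k : (separateLinksᶜ : Finset (Fin 15)),
          Fin (linkSize n (fifteenSenders.C k)))).card = 2 ^ (4 * n) := by
        rw [Finset.card_univ, Fintype.card_pi]
        simp only [Fintype.card_fin, linkSize_fifteenSenders, Finset.prod_const, Finset.card_univ,
          Fintype.card_coe, hsep]
        rw [← pow_mul, mul_comm]
      rw [← hcard, ← Finset.card_product]
      refine Finset.card_le_card_of_injOn (fun m => (m 1, fun k => c.links m k)) ?_ ?_
      · intro m hm
        refine Finset.mem_coe.2 (Finset.mem_product.2 ⟨?_, Finset.mem_univ _⟩)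
        exact Finset.mem_filter.2 ⟨Finset.mem_univ _,
          hupd1 m g (Finset.mem_filter.1 (Finset.mem_coe.1 hm)).2⟩
      · intro m hm m' hm' e
        obtain ⟨hmG, hmg⟩ := Finset.mem_filter.1 (Finset.mem_coe.1 hm)
        obtain ⟨hmG', hmg'⟩ := Finset.mem_filter.1 (Finset.mem_coe.1 hm')
        have hmm := hmg.trans hmg'.symm
        obtain ⟨h0, h3, -⟩ := (hf _ _).1 hmm
        have e1 : m 1 = m' 1 := congrArg Prod.fst e
        have hl := hlinks m m' hmm fun k hk =>
          congrFun (congrArg Prod.snd e) ⟨k, Finset.mem_compl.2 hk⟩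
        have e2 := c.eq_of_links_eq hmG hmG' hl 2 (by
          intro i hi
          have : i = 0 ∨ i = 1 := by simpa [fifteenSenders] using hi
          rcases this with rfl | rfl <;> assumption)
        funext i
        fin_cases i <;> assumption
    have hApos : 0 < A.card := Finset.card_pos.2 ⟨g 1, by simp [hA]⟩
    have hBle : B.card ≤ 2 * 2 ^ (4 * n) := by
      refine Nat.le_of_mul_le_mul_left ?_ hApos
      calc A.card * B.card ≤ _ := hAB
        _ ≤ _ := hdense
        _ ≤ _ := Nat.mul_le_mul_left 2 hcell
        _ = _ := by ring
    refine le_trans (Finset.card_le_card_of_injOn (fun m => m 2) ?_ ?_) hBle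
    all_goals
      have hall : ∀ m ∈ (G'.filter fun m => (∀ i ∈ ({3} : Finset (Fin 4)), m i = g i) ∧
          ∀ k ∈ ({3}ᶜ : Finset (Fin 15)), c.links m k = c.links g k),
          m ∈ G ∧ m 3 = g 3 ∧ c.links m = c.links g ∧ m 0 = g 0 := by
        intro m hm
        obtain ⟨hmG, h3, hk⟩ := Finset.mem_filter.1 hm
        have hmG := (Finset.mem_filter.1 hmG).1
        have h3 := h3 3 (by simp)
        have hl : c.links m = c.links g := by
          funext k
          by_cases hk3 : k = 3
          · subst hk3
            refine c.link_congr fun i hi => ?_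
            obtain rfl : i = 3 := by simpa [fifteenSenders] using hi
            exact h3
          · exact hk k (by simpa using hk3)
        refine ⟨hmG, h3, hl, c.eq_of_links_eq hmG hgG hl 0 fun i hi => ?_⟩
        obtain rfl : i = 3 := by simpa [fifteenSenders] using hi
        exact h3
    · intro m hm
      obtain ⟨hmG, h3, hl, h0⟩ := hall m (Finset.mem_coe.1 hm)
      exact Finset.mem_coe.2 (Finset.mem_filter.2 ⟨Finset.mem_univ _,
        hupd2 m g ((hf _ _).2 ⟨h0, h3, fun k _ => congrFun hl k⟩)⟩)
    · intro m hm m' hm' e2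
      obtain ⟨hmG, h3, hl, h0⟩ := hall m (Finset.mem_coe.1 hm)
      obtain ⟨hmG', h3', hl', h0'⟩ := hall m' (Finset.mem_coe.1 hm')
      have e0 := h0.trans h0'.symm
      have e3 := h3.trans h3'.symm
      have e1 := c.eq_of_links_eq hmG hmG' (hl.trans hl'.symm) 1 (by
        intro i hi
        have : i = 2 ∨ i = 3 := by simpa [fifteenSenders] using hi
        rcases this with rfl | rfl <;> assumption)
      funext i
      fin_cases i <;> assumption)
  simp only [linkSize_fifteenSenders, Finset.prod_const, Finset.prod_singleton, ← pow_mul,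
    Finset.card_compl, Fintype.card_fin, Finset.card_singleton] at hmain
  have hprod : ∏ i, msgSize n (R i) = (∏ i ∈ {0, 1, 2}, msgSize n (R i)) * msgSize n (R 3) := by
    rw [Fin.prod_univ_four, Finset.prod_insert (by decide), Finset.prod_insert (by decide),
      Finset.prod_singleton]
    ring
  refine Nat.le_of_mul_le_mul_right ?_ (msgSize_pos n (R 3))
  rw [← hprod]
  -- At least `3 / 4` of all tuples are correct and at most `1 / 2` are discarded as sparse, so `G'`
  -- has at least `1 / 4`. With the factor 2 from density this gives `2 ^ 3`.
  calc ∏ i, msgSize n (R i) ≤ 4 * G'.card := by omega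
    _ ≤ _ := Nat.mul_le_mul_left 4 hmain
    _ = _ := by ring

/-- All achievable rates are in the closed polytope. -/
lemma achievable_subset_closedPolytope :
    {R | Achievable fifteenSenders R} ⊆ closedPolytope := by
  rintro R ⟨hR, c, hc⟩
  have hev : ∀ᶠ n in atTop, (c n).errorProb < 1 / 4 := hc.eventually_lt_const (by norm_num)
  have hpair : ∀ u v : Fin 4, v ∉ fifteenSenders.A u → ∀ q : ℕ,
      (Finset.univ.filter fun k => (fifteenSenders.S k ∩ {u, v}).Nonempty).card = q →
      ∑ i ∈ {u, v}, R i ≤ q := fun u v huv q hq =>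
    sum_rate_le_of_prod_msgSize_le _ 1 q
      (hev.mono fun n hn => prod_msgSize_pair_le (c n) hn u v huv q hq)
  have htriple : ∑ i ∈ {0, 1, 2}, R i ≤ (18 : ℕ) :=
    sum_rate_le_of_prod_msgSize_le _ 3 18 (hev.mono fun n hn => prod_msgSize_triple_le (c n) hn)
  have h01 := hpair 0 1 (by decide) 12 (by decide)
  have h02 := hpair 0 2 (by decide) 12 (by decide)
  have h30 := hpair 3 0 (by decide) 12 (by decide)
  have h23 := hpair 2 3 (by decide) 12 (by decide)
  rw [Finset.sum_pair (by decide)] at h01 h02 h30 h23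
  rw [Finset.sum_insert (by decide), Finset.sum_pair (by decide)] at htriple
  push_cast at *
  refine ⟨hR, fun j => ?_, h01, h02, by linarith, h23, by linarith⟩
  -- The single-rate bound is the degenerate pair `{j, j}`.
  have := hpair j j (fifteenSenders.not_mem_A j) 8 (by clear * -; revert j; decide)
  simpa using this

end FifteenSenders

/-! ### Achievability: zero-error codes -/

section ZeroError

variable {N K : ℕ} {P : Problem N K}

/-- Encoders over the message alphabets `α` and the link alphabets `β` from which every receiver
can recover its message without error. -/
def HasZeroErrorCode (P : Problem N K) (α : Fin N → Type) (β : Fin K → Type) : Prop :=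
  ∃ enc : ∀ k, (∀ i : {i // i ∈ P.S k}, α i.1) → β k, ∀ (j : Fin N) (m m' : ∀ i, α i),
    (∀ k, enc k (fun i => m i.1) = enc k (fun i => m' i.1)) → (∀ i ∈ P.A j, m i = m' i) →
    m j = m' j

/-- Zero-error codes can be used side by side. -/
lemma HasZeroErrorCode.pi {ι : Type} {α : ι → Fin N → Type} {β : ι → Fin K → Type}
    (h : ∀ s, HasZeroErrorCode P (α s) (β s)) :
    HasZeroErrorCode P (fun i => ∀ s, α s i) (fun k => ∀ s, β s k) := by
  choose enc henc using h
  refine ⟨fun k x s => enc s k fun i => x i s, fun j m m' hl hA => funext fun s => ?_⟩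
  exact henc s j (fun i => m i s) (fun i => m' i s) (fun k => congrFun (hl k) s)
    fun i hi => congrFun (hA i hi) s

/-- Message alphabets can be shrunk, and link alphabets can be enlarged. -/
lemma HasZeroErrorCode.mono {α α' : Fin N → Type} {β β' : Fin K → Type}
    (h : HasZeroErrorCode P α β) (f : ∀ i, α' i ↪ α i) (g : ∀ k, β k ↪ β' k) :
    HasZeroErrorCode P α' β' := by
  obtain ⟨enc, henc⟩ := h
  refine ⟨fun k x => g k (enc k fun i => f i.1 (x i)), fun j m m' hl hA => (f j).injective ?_⟩
  exact henc j (fun i => f i (m i)) (fun i => f i (m' i)) (fun k => (g k).injective (hl k))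
    fun i hi => congrArg _ (hA i hi)

/-- A zero-error code over the alphabets of a block length is a code of that block length. -/
lemma HasZeroErrorCode.exists_code {R : Fin N → ℝ} {n : ℕ}
    (h : HasZeroErrorCode P (fun i => Fin (msgSize n (R i))) (fun k => Fin (linkSize n (P.C k)))) :
    ∃ c : Code P R n, c.errorProb = 0 := by
  classical
  obtain ⟨enc, henc⟩ := h
  let c : Code P R n :=
    { enc := enc
      dec := fun j l a =>
        -- Any message tuple consistent with the received data will do, since all of them agree at
        -- `j`; the value 0 is never used on actual transmissions.
        if hm : ∃ m : Messages R n, (∀ k, enc k (fun i => m i.1) = l k) ∧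
          ∀ i : {i // i ∈ P.A j}, m i.1 = a i then hm.choose j else 0 }
  refine ⟨c, ?_⟩
  have hc : ∀ m, c.estimate m = m := by
    intro m
    funext j
    have hm : ∃ m' : Messages R n, (∀ k, enc k (fun i => m' i.1) = c.links m k) ∧
        ∀ i : {i // i ∈ P.A j}, m' i.1 = m i.1 := ⟨m, fun k => rfl, fun i => rfl⟩
    change (if hm : _ then _ else _) = _
    rw [dif_pos hm]
    exact henc j _ _ hm.choose_spec.1 fun i hi => hm.choose_spec.2 ⟨i, hi⟩
  have : IsEmpty {m : Messages R n // c.estimate m ≠ m} := ⟨fun m => m.2 (hc m)⟩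
  simp [Code.errorProb]

/-- A linear code with scalar links, given by generators `G` and linear decoders `D`. -/
lemma hasZeroErrorCode_of_linear {F : Type} [CommRing F] (r : Fin N → ℕ)
    (G : Fin K → Fin N → ℕ → F) (D : Fin N → ℕ → Fin K → F)
    (hG : ∀ k, ∀ i ∉ P.S k, ∀ l : Fin (r i), G k i l = 0)
    (hD : ∀ j, ∀ l : Fin (r j), ∀ i ∉ P.A j, ∀ l' : Fin (r i),
      ∑ k, D j l k * G k i l' = if i = j ∧ (l' : ℕ) = l then 1 else 0) :
    HasZeroErrorCode P (fun i => Fin (r i) → F) (fun _ => F) := by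
  refine ⟨fun k x => ∑ i : {i // i ∈ P.S k}, ∑ l : Fin (r i.1), G k i.1 l * x i l, fun j m m' hl hA => ?_⟩
  have hfull : ∀ (k : Fin K) (x : ∀ i, Fin (r i) → F),
      ∑ i : {i // i ∈ P.S k}, ∑ l : Fin (r i.1), G k i.1 l * x i.1 l = ∑ i, ∑ l : Fin (r i), G k i l * x i l := by
    intro k x
    rw [Finset.sum_coe_sort (P.S k) (fun i => ∑ l : Fin (r i), G k i l * x i l)]
    refine Finset.sum_subset (Finset.subset_univ _) fun i _ hi => ?_
    exact Finset.sum_eq_zero fun l _ => by rw [hG k i hi l, zero_mul]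
  -- The decoder's combination leaves the wanted symbol plus a function of the side information,
  -- which is the same for `m` and `m'`.
  have hrec : ∀ (x : ∀ i, Fin (r i) → F) (l : Fin (r j)),
      ∑ k, D j l k * ∑ i, ∑ l' : Fin (r i), G k i l' * x i l' =
        x j l + ∑ i ∈ P.A j, ∑ l' : Fin (r i), (∑ k, D j l k * G k i l') * x i l' := by
    intro x l
    have e1 : ∑ k, D j l k * ∑ i, ∑ l' : Fin (r i), G k i l' * x i l' =
        ∑ i, ∑ l' : Fin (r i), (∑ k, D j l k * G k i l') * x i l' := by
      simp only [Finset.mul_sum, Finset.sum_mul, ← mul_assoc]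
      rw [Finset.sum_comm]
      exact Finset.sum_congr rfl fun i _ => Finset.sum_comm
    rw [e1, ← Finset.sum_compl_add_sum (P.A j)]
    congr 1
    rw [Finset.sum_eq_single_of_mem j (Finset.mem_compl.2 (P.not_mem_A j))]
    · rw [Finset.sum_eq_single l]
      · rw [hD j l j (P.not_mem_A j) l]
        simp
      · intro l' _ hne
        rw [hD j l j (P.not_mem_A j) l', if_neg fun h => hne (Fin.ext h.2), zero_mul]
      · simp
    · intro i hi hne
      refine Finset.sum_eq_zero fun l' _ => ?_
      rw [hD j l i (Finset.mem_compl.1 hi) l', if_neg fun h => hne h.1, zero_mul]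
  funext l
  have h := hrec m l
  have h' := hrec m' l
  have hl' : ∀ k, ∑ i, ∑ l' : Fin (r i), G k i l' * m i l' = ∑ i, ∑ l' : Fin (r i), G k i l' * m' i l' := by
    intro k
    rw [← hfull, ← hfull]
    exact hl k
  have hA' : ∑ i ∈ P.A j, ∑ l' : Fin (r i), (∑ k, D j l k * G k i l') * m i l' =
      ∑ i ∈ P.A j, ∑ l' : Fin (r i), (∑ k, D j l k * G k i l') * m' i l' :=
    Finset.sum_congr rfl fun i hi => by rw [hA i hi]
  simp only [hl', hA'] at h
  exact add_right_cancel (h.symm.trans h')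

end ZeroError

/-! ### Achievability: linear codes at the vertices and time sharing -/

/-- The message bits that each sender adds up, at each vertex. -/
def vertexEncoder : Fin 6 → Fin 15 → List (Fin 4 × ℕ) :=
  ![![[(0, 0), (0, 2)], [(1, 5)], [(2, 1)], [(3, 0)], [(0, 1), (1, 4)],
      [(0, 1), (0, 3), (2, 3)], [(2, 3), (3, 3)], [(1, 2), (2, 0)], [(1, 6), (3, 2)],
      [(0, 3), (3, 6)], [(0, 0), (1, 3), (2, 2)], [(1, 1), (3, 7)], [(0, 2), (3, 4)],
      [(1, 0), (3, 5)], [(1, 7), (3, 1)]],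
    ![[(0, 3)], [(1, 4)], [(2, 0)], [(3, 2)], [(0, 0), (1, 7)], [(0, 1), (0, 2), (2, 2)],
      [(2, 2), (3, 5)], [(1, 1), (2, 1)], [(1, 3), (3, 4)], [(0, 0), (3, 0)],
      [(0, 1), (1, 5), (2, 5)], [(1, 6), (3, 1)], [(0, 2), (3, 3)], [(1, 0), (2, 3)],
      [(1, 2), (2, 4)]],
    ![[(0, 0)], [(1, 2)], [(2, 4)], [(3, 3)], [(1, 6)], [(0, 1), (2, 2)], [(2, 3)],
      [(1, 4), (2, 5)], [(1, 3), (3, 2)], [(0, 1), (3, 1)], [(1, 1), (2, 0)],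
      [(1, 5), (3, 0)], [(2, 6)], [(1, 0), (2, 7)], [(1, 7), (2, 1)]],
    ![[(0, 1)], [(1, 4)], [(2, 3)], [(3, 3)], [(0, 3)], [(2, 4)], [(2, 6), (3, 1)],
      [(1, 2), (2, 1)], [(1, 5), (3, 0)], [(0, 0), (3, 1)], [(1, 1), (2, 5)],
      [(0, 2), (3, 2)], [(0, 2), (2, 0)], [(1, 3), (2, 2)], [(1, 0), (2, 7)]],
    ![[(0, 3)], [(1, 1)], [(2, 4)], [(3, 5)], [(0, 0)], [(0, 1), (2, 2)], [(2, 2), (3, 3)],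
      [(1, 5), (2, 1)], [(1, 3), (3, 0)], [(0, 2), (3, 2)], [(0, 4), (1, 4), (2, 3)],
      [(0, 5), (3, 4)], [(0, 4), (3, 1)], [(1, 0), (2, 0), (3, 4)],
      [(1, 2), (2, 5), (3, 2)]],
    ![[(0, 1)], [(1, 2)], [(2, 1)], [(3, 1), (3, 3)], [(0, 6)], [(0, 3)], [(2, 3), (3, 3)],
      [(1, 0), (2, 2)], [(1, 3), (3, 2)], [(0, 5)], [(0, 7)], [(0, 4), (3, 0)],
      [(0, 0), (3, 1)], [(1, 1), (2, 0), (3, 0)], [(0, 2)]]]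

/-- The links that receiver `j` adds up, and corrects by its side information, to recover the
bits of its message, at each vertex. -/
def vertexDecoder : Fin 6 → Fin 4 → List (List (Fin 15)) :=
  ![![[[0, 12], [5, 6, 9], [12], [9]],
      [[13], [11], [7], [0, 10, 12], [4, 5, 9], [1], [8], [14]],
      [[7], [2], [10], [5]],
      [[3], [14], [8], [6], [0, 10, 12], [13], [4, 5, 9], [11]]],
    ![[[9], [5, 6, 12], [12], [0]],
      [[13], [7], [14], [8], [1], [5, 10, 12], [11], [4, 9]],
      [[2], [7], [5], [13], [14], [10]],
      [[4, 9], [11], [3], [5, 10, 12], [8], [6]]],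
    ![[[0], [9]],
      [[13], [10], [1], [8], [7], [11], [4], [14]],
      [[10], [14], [5], [6], [2], [7], [12], [13]],
      [[11], [5, 9], [8], [3]]],
    ![[[9], [0], [11], [4]],
      [[14], [10], [7], [13], [1], [8]],
      [[12], [7], [13], [2], [5], [10], [6, 9], [14]],
      [[8], [6], [11, 12], [3]]],
    ![[[4], [5, 6], [9], [0], [12], [11]],
      [[13], [1], [14], [8], [10, 12], [7]],
      [[11, 13], [7], [5], [10], [2], [9, 14]],
      [[8], [10, 12], [14], [6], [13], [3]]],
    ![[[12], [0], [14], [5], [11], [9], [4], [10]],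
      [[7], [13], [1], [8]],
      [[11, 13], [2], [7], [3, 6, 12]],
      [[13], [3, 6], [8], [6]]]]

/-- Each vertex is attained by a binary linear code of block length one. -/
lemma hasZeroErrorCode_vertex (v : Fin 6) :
    HasZeroErrorCode fifteenSenders (fun i => Fin (vertexRate v i) → ZMod 2) (fun _ => ZMod 2) := by
  refine hasZeroErrorCode_of_linear (vertexRate v)
    (fun k i l => if (i, l) ∈ vertexEncoder v k then 1 else 0)
    (fun j l k => if k ∈ (vertexDecoder v j).getD l [] then 1 else 0) ?_ ?_
  · revert v
    decide +kernel
  · revert v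
    decide +kernel

/-- Time sharing between the codes of the vertices. -/
lemma hasZeroErrorCode_timeSharing {R : Fin 4 → ℝ} {n : ℕ} (t : Fin 6 → ℕ)
    (ht : ∑ v, t v ≤ n) (hR : ∀ i, ⌈(n : ℝ) * R i⌉₊ ≤ ∑ v, t v * vertexRate v i) :
    HasZeroErrorCode fifteenSenders (fun i => Fin (msgSize n (R i)))
      (fun k => Fin (linkSize n (fifteenSenders.C k))) := by
  have h := HasZeroErrorCode.pi (ι := Σ v, Fin (t v)) fun s => hasZeroErrorCode_vertex s.1
  refine h.mono (fun i => (Function.Embedding.nonempty_of_card_le ?_).some)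
    (fun k => (Function.Embedding.nonempty_of_card_le ?_).some)
  · rw [Fintype.card_fin, Fintype.card_pi, msgSize]
    simp only [Fintype.card_fun, Fintype.card_fin, ZMod.card]
    rw [Finset.prod_pow_eq_pow_sum]
    refine Nat.pow_le_pow_right two_pos ((hR i).trans_eq ?_)
    rw [Fintype.sum_sigma]
    simp
  · rw [Fintype.card_fin, linkSize_fifteenSenders, Fintype.card_pi]
    simp only [ZMod.card]
    rw [Finset.prod_const, Finset.card_univ, Fintype.card_sigma]
    simp only [Fintype.card_fin]
    exact Nat.pow_le_pow_right two_pos ht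

/-- All rates in the open polytope are achievable. -/
lemma openPolytope_subset_achievable : openPolytope ⊆ {R | Achievable fifteenSenders R} := by
  intro R hR
  obtain ⟨w, hw, hs, hlt⟩ := exists_weights_of_mem_openPolytope hR
  have hlarge : ∀ᶠ n : ℕ in atTop, ∃ c : Code fifteenSenders R n, c.errorProb = 0 := by
    -- The left side covers the rounding: less than one copy is lost at each vertex, and less than
    -- one bit in the ceiling of `n * R i`.
    have hi : ∀ᶠ n : ℕ in atTop, ∀ i,
        (1 + ∑ v, (vertexRate v i : ℝ)) ≤ n * (∑ v, w v * (vertexRate v i : ℝ) - R i) := by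
      refine eventually_all.2 fun i => ?_
      have : Tendsto (fun n : ℕ => (n : ℝ) * (∑ v, w v * (vertexRate v i : ℝ) - R i)) atTop atTop :=
        tendsto_natCast_atTop_atTop.atTop_mul_const (sub_pos.2 (hlt i))
      exact this.eventually_ge_atTop _
    filter_upwards [hi] with n hn
    refine (hasZeroErrorCode_timeSharing (fun v => ⌊(n : ℝ) * w v⌋₊) ?_ fun i => ?_).exists_code
    · have h1 : ∑ v, (⌊(n : ℝ) * w v⌋₊ : ℝ) ≤ n := by
        calc _ ≤ ∑ v, (n : ℝ) * w v :=
              Finset.sum_le_sum fun v _ => Nat.floor_le (mul_nonneg n.cast_nonneg (hw v))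
          _ = n * ∑ v, w v := by rw [Finset.mul_sum]
          _ ≤ n := mul_le_of_le_one_right n.cast_nonneg hs.le
      exact_mod_cast h1
    · have h1 : (n : ℝ) * R i + 1 ≤ ∑ v, (⌊(n : ℝ) * w v⌋₊ : ℝ) * vertexRate v i := by
        have h2 : ∑ v, ((n : ℝ) * w v - 1) * vertexRate v i ≤
            ∑ v, (⌊(n : ℝ) * w v⌋₊ : ℝ) * vertexRate v i :=
          Finset.sum_le_sum fun v _ =>
            mul_le_mul_of_nonneg_right (Nat.sub_one_lt_floor _).le (Nat.cast_nonneg _)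
        have h3 : ∑ v, ((n : ℝ) * w v - 1) * vertexRate v i =
            n * ∑ v, w v * (vertexRate v i : ℝ) - ∑ v, (vertexRate v i : ℝ) := by
          rw [Finset.mul_sum, ← Finset.sum_sub_distrib]
          exact Finset.sum_congr rfl fun v _ => by ring
        have := hn i
        rw [mul_sub] at this
        linarith
      have h4 := Nat.ceil_lt_add_one (mul_nonneg n.cast_nonneg (hR.1 i) : 0 ≤ (n : ℝ) * R i)
      exact_mod_cast (h4.trans_le h1).le
  refine ⟨hR.1, ?_⟩
  have hcode : ∀ n, Nonempty (Code fifteenSenders R n) := fun n =>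
    ⟨{ enc := fun _ _ => 0, dec := fun _ _ _ => 0 }⟩
  have hc : ∀ n, ∃ c : Code fifteenSenders R n,
      (∃ c : Code fifteenSenders R n, c.errorProb = 0) → c.errorProb = 0 := by
    intro n
    by_cases h : ∃ c : Code fifteenSenders R n, c.errorProb = 0
    · exact ⟨h.choose, fun _ => h.choose_spec⟩
    · exact ⟨(hcode n).some, fun h' => absurd h' h⟩
  choose c hc using hc
  exact ⟨c, tendsto_const_nhds.congr' (hlarge.mono fun n hn => (hc n hn).symm)⟩

/-! ### Identification of the regions -/

lemma cccRegionOf_fifteenSendersChoice :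
    cccRegionOf fifteenSenders fifteenSendersChoice = openPolytope :=
  (cccRegionOf_subset_openPolytope (by unfold IsDecodingChoice; decide)).antisymm
    openPolytope_subset_cccRegionOf

lemma convex_openPolytope : Convex ℝ openPolytope := by
  rintro x ⟨x0, x8, x1, x2, x3, x4, x5⟩ y ⟨y0, y8, y1, y2, y3, y4, y5⟩ a b ha hb hab
  have key : ∀ {s t c : ℝ}, s < c → t < c → a * s + b * t < c := fun {s t c} hs ht =>
    (convex_Iio c) hs ht ha hb hab
  refine ⟨fun j => ?_, fun j => ?_, ?_, ?_, ?_, ?_, ?_⟩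
  · exact add_nonneg (mul_nonneg ha (x0 j)) (mul_nonneg hb (y0 j))
  · exact key (x8 j) (y8 j)
  all_goals simp only [Pi.add_apply, Pi.smul_apply, smul_eq_mul]
  · linarith [key x1 y1]
  · linarith [key x2 y2]
  · linarith [key x3 y3]
  · linarith [key x4 y4]
  · linarith [key x5 y5]

lemma cccRegion_fifteenSenders : cccRegion fifteenSenders = openPolytope := by
  refine Set.Subset.antisymm (convexHull_min ?_ convex_openPolytope) ?_
  · exact Set.iUnion₂_subset fun D hD => cccRegionOf_subset_openPolytope hD
  · rw [← cccRegionOf_fifteenSendersChoice]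
    refine Set.Subset.trans ?_ (subset_convexHull ℝ _)
    exact Set.subset_biUnion_of_mem (u := fun D => cccRegionOf fifteenSenders D)
      (by simp only [Set.mem_ofPred_eq]; unfold IsDecodingChoice; decide)

lemma isClosed_closedPolytope : IsClosed closedPolytope := by
  have hj : ∀ j : Fin 4, Continuous fun R : Fin 4 → ℝ => R j := fun j => continuous_apply j
  unfold closedPolytope
  simp only [Set.ofPred_and, Set.ofPred_forall]
  refine (isClosed_iInter fun j => isClosed_le continuous_const (hj j)).inter
    ((isClosed_iInter fun j => isClosed_le (hj j) continuous_const).inter ?_)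
  refine (isClosed_le ?_ continuous_const).inter ((isClosed_le ?_ continuous_const).inter
    ((isClosed_le ?_ continuous_const).inter ((isClosed_le ?_ continuous_const).inter
    (isClosed_le ?_ continuous_const)))) <;> fun_prop

/-- All upper bounds are positive, so scaling by `t < 1` makes them strict while keeping the
coordinates nonnegative; let `t` tend to 1. -/
lemma closure_openPolytope : closure openPolytope = closedPolytope := by
  refine Set.Subset.antisymm (closure_minimal ?_ isClosed_closedPolytope) ?_
  · rintro x ⟨h0, h8, h1, h2, h3, h4, h5⟩
    exact ⟨h0, fun j => (h8 j).le, h1.le, h2.le, h3.le, h4.le, h5.le⟩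
  · rintro R ⟨h0, h8, h1, h2, h3, h4, h5⟩
    have ht : Tendsto (fun t : ℝ => t • R) (𝓝[<] 1) (𝓝 R) := by
      have : Tendsto (fun t : ℝ => t • R) (𝓝 1) (𝓝 ((1 : ℝ) • R)) :=
        (continuous_id.smul continuous_const).tendsto 1
      rw [one_smul] at this
      exact this.mono_left nhdsWithin_le_nhds
    refine mem_closure_of_tendsto ht ?_
    filter_upwards [Ioo_mem_nhdsLT (zero_lt_one' ℝ)] with t htt
    have key : ∀ {s c : ℝ}, 0 < c → s ≤ c → t * s < c := fun {s c} hc hs => by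
      nlinarith [mul_le_mul_of_nonneg_left hs htt.1.le, mul_lt_mul_of_pos_right htt.2 hc]
    refine ⟨fun j => mul_nonneg htt.1.le (h0 j), fun j => key (by norm_num) (h8 j), ?_⟩
    simp only [Pi.smul_apply, smul_eq_mul, ← mul_add]
    exact ⟨key (by norm_num) h1, key (by norm_num) h2, key (by norm_num) h3, key (by norm_num) h4,
      key (by norm_num) h5⟩

lemma capacityRegion_fifteenSenders : capacityRegion fifteenSenders = closedPolytope := by
  refine Set.Subset.antisymm
    (closure_minimal achievable_subset_closedPolytope isClosed_closedPolytope) ?_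
  rw [← closure_openPolytope]
  exact closure_mono openPolytope_subset_achievable

/-! ### Comparison with the MAIS bound -/

/-- Two receivers that know each other's messages form a cycle. -/
lemma not_inducedAcyclic_of_two_cycle {N K : ℕ} {P : Problem N K} {V : Finset (Fin N)}
    {u v : Fin N} (hu : u ∈ V) (hv : v ∈ V) (huv : v ∈ P.A u) (hvu : u ∈ P.A v) :
    ¬ InducedAcyclic P V := fun h =>
  h u ((Relation.TransGen.single ⟨hu, hv, huv⟩).tail ⟨hv, hu, hvu⟩)

/-- Three receivers each of which knows the message of the next form a cycle. -/
lemma not_inducedAcyclic_of_three_cycle {N K : ℕ} {P : Problem N K} {V : Finset (Fin N)}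
    {u v w : Fin N} (hu : u ∈ V) (hv : v ∈ V) (hw : w ∈ V) (huv : v ∈ P.A u) (hvw : w ∈ P.A v)
    (hwu : u ∈ P.A w) : ¬ InducedAcyclic P V := fun h =>
  h u (((Relation.TransGen.single ⟨hu, hv, huv⟩).tail ⟨hv, hw, hvw⟩).tail ⟨hw, hu, hwu⟩)

/-- The cycles 1-2, 1-3 and 0-3-2 exclude every other set. Acyclicity of the listed sets is not
needed to place a point in the MAIS region. -/
lemma mem_of_inducedAcyclic {V : Finset (Fin 4)} (hV : InducedAcyclic fifteenSenders V) :
    V = ∅ ∨ (∃ j, V = {j}) ∨ V = {0, 1} ∨ V = {0, 2} ∨ V = {0, 3} ∨ V = {2, 3} := by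
  have h12 : ¬ (1 ∈ V ∧ 2 ∈ V) := fun h =>
    not_inducedAcyclic_of_two_cycle h.1 h.2 (by decide) (by decide) hV
  have h13 : ¬ (1 ∈ V ∧ 3 ∈ V) := fun h =>
    not_inducedAcyclic_of_two_cycle h.1 h.2 (by decide) (by decide) hV
  have h032 : ¬ (0 ∈ V ∧ 3 ∈ V ∧ 2 ∈ V) := fun h =>
    not_inducedAcyclic_of_three_cycle h.1 h.2.1 h.2.2 (by decide) (by decide) (by decide) hV
  clear hV
  revert V
  decide

/-- The MAIS outer bound of the instance is implied by the cut-set inequalities. -/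
lemma mem_maisRegion {R : Fin 4 → ℝ} (h0 : ∀ j, 0 ≤ R j) (h8 : ∀ j, R j ≤ 8)
    (h01 : R 0 + R 1 ≤ 12) (h02 : R 0 + R 2 ≤ 12) (h03 : R 0 + R 3 ≤ 12) (h23 : R 2 + R 3 ≤ 12) :
    R ∈ maisRegion fifteenSenders := by
  refine ⟨h0, fun V hV => ?_⟩
  have hC : ∀ (U : Finset (Fin 4)) (q : ℕ),
      (Finset.univ.filter fun k => (fifteenSenders.S k ∩ U).Nonempty).card = q →
      ∑ k with (fifteenSenders.S k ∩ U).Nonempty, fifteenSenders.C k = q := by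
    intro U q hq
    simp [fifteenSenders, ← hq]
  rcases mem_of_inducedAcyclic hV with rfl | ⟨j, rfl⟩ | rfl | rfl | rfl | rfl
  · simp
  · rw [hC {j} 8 (by clear * -; revert j; decide), Finset.sum_singleton]
    exact h8 j
  all_goals
    rw [hC _ 12 (by decide), Finset.sum_pair (by decide)]
    assumption

lemma capacityRegion_ssubset_maisRegion :
    capacityRegion fifteenSenders ⊂ maisRegion fifteenSenders := by
  rw [capacityRegion_fifteenSenders]
  refine ⟨fun R ⟨h0, h8, h1, h2, h3, h4, _⟩ => mem_maisRegion h0 h8 h1 h2 h3 h4, fun h => ?_⟩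
  -- This point meets all single and pair bounds, but its first three rates add up to 20.
  have hmem : (![4, 8, 8, 4] : Fin 4 → ℝ) ∈ maisRegion fifteenSenders := by
    refine mem_maisRegion ?_ ?_ ?_ ?_ ?_ ?_
    · intro j; fin_cases j <;> norm_num
    · intro j; fin_cases j <;> norm_num
    all_goals (simp; norm_num)
  have := (h hmem).2.2.2.2.2.2
  simp at this
  norm_num at this

end IndexCoding

theorem mainTheorem4 :
    IndexCoding.IsDecodingChoice IndexCoding.fifteenSenders IndexCoding.fifteenSendersChoice ∧
    IndexCoding.cccRegionOf IndexCoding.fifteenSenders IndexCoding.fifteenSendersChoice =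
      {R : Fin 4 → ℝ | (∀ j, 0 ≤ R j) ∧ (∀ j, R j < 8) ∧
        R 0 + R 1 < 12 ∧ R 0 + R 2 < 12 ∧ R 0 + R 3 < 12 ∧ R 2 + R 3 < 12 ∧
        R 0 + R 1 + R 2 < 18} ∧
    IndexCoding.cccRegion IndexCoding.fifteenSenders =
      IndexCoding.cccRegionOf IndexCoding.fifteenSenders IndexCoding.fifteenSendersChoice ∧
    closure (IndexCoding.cccRegion IndexCoding.fifteenSenders) =
      IndexCoding.capacityRegion IndexCoding.fifteenSenders ∧
    IndexCoding.capacityRegion IndexCoding.fifteenSenders =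
      {R : Fin 4 → ℝ | (∀ j, 0 ≤ R j) ∧ (∀ j, R j ≤ 8) ∧
        R 0 + R 1 ≤ 12 ∧ R 0 + R 2 ≤ 12 ∧ R 0 + R 3 ≤ 12 ∧ R 2 + R 3 ≤ 12 ∧
        R 0 + R 1 + R 2 ≤ 18} ∧
    IndexCoding.capacityRegion IndexCoding.fifteenSenders ⊂
      IndexCoding.maisRegion IndexCoding.fifteenSenders :=
  ⟨by unfold IndexCoding.IsDecodingChoice; decide, IndexCoding.cccRegionOf_fifteenSendersChoice,
    by rw [IndexCoding.cccRegion_fifteenSenders, IndexCoding.cccRegionOf_fifteenSendersChoice],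
    by rw [IndexCoding.cccRegion_fifteenSenders, IndexCoding.closure_openPolytope,
      IndexCoding.capacityRegion_fifteenSenders],
    IndexCoding.capacityRegion_fifteenSenders, IndexCoding.capacityRegion_ssubset_maisRegion⟩
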